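/- Let a Runge--Kutta method with real coefficient matrix $A=(a_{ij})_{i,j=1}^{m}$, weights $\mathbf b=(b_1,\dots,b_m)^T$ and abscissae $c_i\in[0,1]$ be given. Assume that $A$ is invertible, that the method has classical order at least one, that $a_{m,j}=b_j$ for $j=1,\dots,m$, and that it is $A$-stable, i.e. $|r(z)|\le 1$ for $\operatorname{Re}z\le 0$, where $$r(z)=1+z\,\mathbf b^T(I-zA)^{-1}\mathbb 1,\qquad \mathbf q(z)=\mathbf b^T(I-zA)^{-1},\qquad \mathbb 1=(1,\dots,1)^T .$$ Let $\boldsymbol\Delta(\zeta)=A^{-1}-\zeta A^{-1}\mathbb 1\mathbf b^TA^{-1}$, let $\mathbf E_n(z)$ be defined by $(\boldsymbol\Delta(\zeta)-zI)^{-1}=\sum_{n\ge 0}\mathbf E_n(z)\zeta^n$, and let $\mathbf e_n(z)$ be the last row of $\mathbf E_n(z)$ (so that $\mathbf e_n(z)=r(z)^n\mathbf q(z)$). Let $\|\cdot\|$ be a norm on $\mathbb C^m$ and let $\gamma>1$, $b>0$, $C_{\mathbf q}>0$ be constants such that $I-zA$ is invertible for $\operatorname{Re}z\le b$, $$|r(z)|\le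 e^{\gamma\operatorname{Re}z}\ \text{ for } 0\le\operatorname{Re}z\le b,\qquad \|\mathbf q(z)\|\le C_{\mathbf q}\ \text{ for }\operatorname{Re}z\le b .$$ Let $\alpha\in(0,1)$, $h,T,L_0>0$, let $n\ge 0$ be an integer with $nh\le T$, and let $Q\ge 1$. Let $x_1,\dots,x_Q$ and $w_1,\dots,w_Q$ be the nodes and weights of the $Q$-point Gauss--Jacobi quadrature for the weight function $(1+x)^{-\alpha}$ on $[-1,1]$, i.e. of the $Q$-point formula that is exact for this weight on polynomials of degree at most $2Q-1$. Put $$\mathbf f_0(x)=\frac{h\sin(\pi\alpha)}{\pi}\Big(\frac{L_0}{2}\Big)^{1-\alpha}\mathbf e_n\big(-h(x+1)L_0/2\big),\qquad \boldsymbol\tau_{\mathrm{GJ},n}(Q)=\sum_{j=1}^{Q}w_j\mathbf f_0(x_j)-\int_{-1}^{1}(1+x)^{-\alpha}\mathbf f_0(x)\,dx ,$$ where the integral equals $\frac{h\sin(\pi\alpha)}{\pi}\int_0^{L_0}x^{-\alpha}\mathbf e_n(-xh)\,dx$. Let $$\varrho_{\max}=1+\frac{2b}{L_0h}+\sqrt{\Big(\frac{2b}{L_0h}\Big)^2+\frac{4b}{L_0h}},\qquad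 \varrho_{\mathrm{opt}}=\frac{4Q}{\gamma TL_0}+\sqrt{1+\Big(\frac{4Q}{\gamma TL_0}\Big)^2}.$$ If $\varrho_{\mathrm{opt}}\in(1,\varrho_{\max})$, then $$\|\boldsymbol\tau_{\mathrm{GJ},n}(Q)\|\le C_{\mathbf q}\,\frac{hL_0^{1-\alpha}\sin(\pi\alpha)}{\pi(1-\alpha)}\Big(1+\frac{\gamma TL_0}{4Q}\Big)\Big(\frac{e\gamma TL_0}{8Q}\Big)^{2Q}.$$ Otherwise, $$\|\boldsymbol\tau_{\mathrm{GJ},n}(Q)\|\le C_{\mathbf q}\,\frac{hL_0^{1-\alpha}\sin(\pi\alpha)}{\pi(1-\alpha)}\cdot\frac{\varrho_{\max}^{-2Q+1}}{\varrho_{\max}-1}\,e^{\gamma Tb/h}.$$ -/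

import Mathlib

open Matrix

noncomputable section

/-- A Runge--Kutta method with `s + 1` stages (so that there is always a last stage,
`Fin.last s`): coefficient matrix `A`, weights `b`, abscissae `c`. -/
structure RungeKutta (s : ℕ) where
  A : Matrix (Fin (s + 1)) (Fin (s + 1)) ℝ
  b : Fin (s + 1) → ℝ
  c : Fin (s + 1) → ℝ

namespace RungeKutta

variable {s : ℕ} (R : RungeKutta s)

/-- The coefficient matrix, with its entries regarded as complex numbers. -/
def Ac : Matrix (Fin (s + 1)) (Fin (s + 1)) ℂ := R.A.map Complex.ofReal

/-- The vector of weights, with its entries regarded as complex numbers. -/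
def bc : Fin (s + 1) → ℂ := fun i => (R.b i : ℂ)

/-- The stability function `r(z) = 1 + z bᵀ (I - z A)⁻¹ 𝟙`. -/
def r (z : ℂ) : ℂ := 1 + z * (R.bc ⬝ᵥ ((1 - z • R.Ac)⁻¹ *ᵥ 1))

/-- The row vector `q(z) = bᵀ (I - z A)⁻¹`. -/
def q (z : ℂ) : Fin (s + 1) → ℂ := R.bc ᵥ* (1 - z • R.Ac)⁻¹

/-- The symbol `Δ(ζ) = A⁻¹ - ζ A⁻¹ 𝟙 bᵀ A⁻¹`, as a power series in `ζ`
with matrix coefficients. -/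
def symbol : PowerSeries (Matrix (Fin (s + 1)) (Fin (s + 1)) ℂ) :=
  PowerSeries.C R.Ac⁻¹
    - PowerSeries.X * PowerSeries.C (R.Ac⁻¹ * vecMulVec 1 R.bc * R.Ac⁻¹)

/-- The matrices `E n z` with `(Δ(ζ) - z I)⁻¹ = ∑ₙ E n z ζⁿ`. -/
def E (n : ℕ) (z : ℂ) : Matrix (Fin (s + 1)) (Fin (s + 1)) ℂ :=
  PowerSeries.coeff n (Ring.inverse (R.symbol - PowerSeries.C (z • 1)))

/-- The last row of `E n z`. -/
def e (n : ℕ) (z : ℂ) : Fin (s + 1) → ℂ := R.E n z (Fin.last s)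

/-- The standing assumptions on the method. Classical order at least one is the condition
`∑ b i = 1`. `A`-stability is `|r(z)| ≤ 1` on the closed left half-plane. -/
structure IsAdmissible : Prop where
  abscissae : ∀ i, R.c i ∈ Set.Icc (0 : ℝ) 1
  invertible : IsUnit R.A.det
  order_one : ∑ i, R.b i = 1
  stifflyAccurate : ∀ j, R.A (Fin.last s) j = R.b j
  aStable : ∀ z : ℂ, z.re ≤ 0 → ‖R.r z‖ ≤ 1

/-- `γ > 1`, `b > 0`, `Cq > 0` are constants such that `r` and `q` have no singularity in the
half-plane `Re z ≤ b`, `|r(z)| ≤ exp (γ Re z)` for `0 ≤ Re z ≤ b`, and `‖q(z)‖ ≤ Cq` for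
`Re z ≤ b`, where `‖·‖` is the norm `N`. -/
structure HasBounds (N : Seminorm ℂ (Fin (s + 1) → ℂ)) (γ b Cq : ℝ) : Prop where
  one_lt : 1 < γ
  b_pos : 0 < b
  Cq_pos : 0 < Cq
  regular : ∀ z : ℂ, z.re ≤ b → IsUnit (1 - z • R.Ac).det
  r_le : ∀ z : ℂ, 0 ≤ z.re → z.re ≤ b → ‖R.r z‖ ≤ Real.exp (γ * z.re)
  q_le : ∀ z : ℂ, z.re ≤ b → N (R.q z) ≤ Cq

/-- The integrand `f₀(x) = h sin(πα) / π (L₀ / 2)^(1 - α) eₙ(-h (x + 1) L₀ / 2)`. -/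
def f₀ (α h L₀ : ℝ) (n : ℕ) (x : ℝ) : Fin (s + 1) → ℂ :=
  (h * Real.sin (Real.pi * α) / Real.pi * (L₀ / 2) ^ (1 - α)) •
    R.e n ((-h * (x + 1) * L₀ / 2 : ℝ) : ℂ)

/-- The initial piece `h sin(πα) / π ∫₀^{L₀} x^(-α) eₙ(-x h) dx` of the integral for the
convolution quadrature weight. -/
def I₀ (α h L₀ : ℝ) (n : ℕ) : Fin (s + 1) → ℂ :=
  (h * Real.sin (Real.pi * α) / Real.pi) •
    ∫ x in (0 : ℝ)..L₀, x ^ (-α) • R.e n ((-x * h : ℝ) : ℂ)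

/-- The quadrature error `τ = ∑ⱼ wⱼ f₀(xⱼ) - ∫_{-1}^1 (1 + x)^(-α) f₀(x) dx`. -/
def quadError (α h L₀ : ℝ) (n : ℕ) {Q : ℕ} (x w : Fin Q → ℝ) : Fin (s + 1) → ℂ :=
  (∑ j, w j • R.f₀ α h L₀ n (x j))
    - ∫ y in (-1 : ℝ)..1, (1 + y) ^ (-α) • R.f₀ α h L₀ n y

/-- Change of variables: the integral in `quadError` is the initial piece `I₀`. -/
theorem integral_f₀ {α h L₀ : ℝ} (hL : 0 < L₀) (n : ℕ) :
    ∫ y in (-1 : ℝ)..1, (1 + y) ^ (-α) • R.f₀ α h L₀ n y = R.I₀ α h L₀ n := by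
  have hL2 : (0 : ℝ) < L₀ / 2 := by positivity
  have key := intervalIntegral.smul_integral_comp_mul_add
    (a := (-1 : ℝ)) (b := 1)
    (fun x : ℝ => x ^ (-α) • R.e n ((-x * h : ℝ) : ℂ)) (L₀ / 2) (L₀ / 2)
  have e1 : L₀ / 2 * -1 + L₀ / 2 = 0 := by ring
  have e2 : L₀ / 2 * 1 + L₀ / 2 = L₀ := by ring
  rw [e1, e2] at key
  unfold I₀
  rw [← key, ← intervalIntegral.integral_smul, ← intervalIntegral.integral_smul]
  apply intervalIntegral.integral_congr
  intro y hy
  rw [Set.uIcc_of_le (by norm_num)] at hy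
  have hy1 : 0 ≤ 1 + y := by linarith [hy.1]
  have e3 : L₀ / 2 * y + L₀ / 2 = (L₀ / 2) * (1 + y) := by ring
  have e4 : -(L₀ / 2 * (1 + y)) * h = -h * (y + 1) * L₀ / 2 := by ring
  have e5 : (L₀ / 2) ^ (1 - α) = (L₀ / 2) * (L₀ / 2) ^ (-α) := by
    rw [sub_eq_add_neg, Real.rpow_add hL2, Real.rpow_one]
  simp only [f₀, e3, e4, smul_smul]
  congr 1
  rw [Real.mul_rpow hL2.le hy1, e5]
  ring

/-- The explicit formula `eₙ(z) = r(z)ⁿ q(z)`. -/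
theorem e_eq (hA : IsUnit R.A.det) (hs : ∀ j, R.A (Fin.last s) j = R.b j) (n : ℕ) {z : ℂ}
    (hz : IsUnit (1 - z • R.Ac).det) : R.e n z = R.r z ^ n • R.q z := by
  have hAc : IsUnit R.Ac.det := by
    have h1 : R.Ac.det = ((R.A.det : ℝ) : ℂ) := (RingHom.map_det Complex.ofRealHom R.A).symm
    rw [h1]
    exact hA.map Complex.ofRealHom
  set A := R.Ac with hAdef
  set G := (1 - z • A)⁻¹ with hG
  have hGl : G * (1 - z • A) = 1 := nonsing_inv_mul _ hz
  have hGr : (1 - z • A) * G = 1 := mul_nonsing_inv _ hz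
  have hIl : A⁻¹ * A = 1 := nonsing_inv_mul _ hAc
  have hIr : A * A⁻¹ = 1 := mul_nonsing_inv _ hAc
  set D0 : Matrix (Fin (s + 1)) (Fin (s + 1)) ℂ := A⁻¹ - z • 1 with hD0
  set D1 : Matrix (Fin (s + 1)) (Fin (s + 1)) ℂ := A⁻¹ * vecMulVec 1 R.bc * A⁻¹ with hD1
  have hD0A : D0 = (1 - z • A) * A⁻¹ := by
    rw [hD0, sub_mul, smul_mul_assoc, hIr, one_mul]
  have hD0r : D0 * (A * G) = 1 := by
    rw [hD0A, Matrix.mul_assoc, ← Matrix.mul_assoc A⁻¹, hIl, Matrix.one_mul, hGr]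
  have hD0l : (A * G) * D0 = 1 := mul_eq_one_comm.mp hD0r
  set M := (A * G) * D1 with hM
  have hser : R.symbol - PowerSeries.C (z • 1)
      = PowerSeries.C D0 - PowerSeries.X * PowerSeries.C D1 := by
    simp only [symbol, hD0, hD1, map_sub, ← hAdef]
    abel
  let P : PowerSeries (Matrix (Fin (s + 1)) (Fin (s + 1)) ℂ) :=
    PowerSeries.mk fun n => M ^ n * (A * G)
  have hDP : (PowerSeries.C D0 - PowerSeries.X * PowerSeries.C D1) * P = 1 := by
    ext1 k
    rw [sub_mul, mul_assoc, map_sub, PowerSeries.coeff_C_mul]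
    cases k with
    | zero => simp [P, PowerSeries.coeff_zero_X_mul, hD0r]
    | succ k =>
      rw [PowerSeries.coeff_succ_X_mul, PowerSeries.coeff_C_mul]
      simp only [P, PowerSeries.coeff_mk, PowerSeries.coeff_one]
      rw [pow_succ', hM]
      simp only [← Matrix.mul_assoc]
      rw [Matrix.mul_assoc D0 A G, hD0r]
      simp
  have hPD : P * (PowerSeries.C D0 - PowerSeries.X * PowerSeries.C D1) = 1 := by
    ext1 k
    rw [mul_sub, ← mul_assoc, map_sub, PowerSeries.coeff_mul_C, PowerSeries.coeff_mul_C]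
    cases k with
    | zero => simp [P, PowerSeries.coeff_zero_mul_X, hD0l]
    | succ k =>
      rw [PowerSeries.coeff_succ_mul_X]
      simp only [P, PowerSeries.coeff_mk, PowerSeries.coeff_one]
      rw [Matrix.mul_assoc, hD0l, pow_succ, hM]
      simp [Matrix.mul_assoc]
  have hinv : Ring.inverse (R.symbol - PowerSeries.C (z • 1)) = P := by
    rw [hser]
    exact Ring.inverse_unit
      (⟨PowerSeries.C D0 - PowerSeries.X * PowerSeries.C D1, P, hDP, hPD⟩ : Units _)
  have hE : ∀ k, R.E k z = M ^ k * (A * G) := by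
    intro k
    rw [E, hinv]
    simp [P]
  have hrow : A (Fin.last s) = R.bc := by
    funext j
    simp [hAdef, Ac, bc, hs j]
  have hbA : R.bc ᵥ* A⁻¹ = Pi.single (Fin.last s) 1 := by
    have h1 : R.bc = Pi.single (Fin.last s) 1 ᵥ* A := by
      rw [single_one_vecMul]
      exact hrow.symm
    rw [h1, vecMul_vecMul, hIr, vecMul_one]
  have hG1 : G = 1 + z • (A * G) := by
    have h2 : (1 - z • A) * G = G - z • (A * G) := by
      rw [sub_mul, Matrix.one_mul, smul_mul_assoc]
    rw [hGr] at h2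
    rw [h2]
    abel
  have hrG : R.r z = (G *ᵥ 1) (Fin.last s) := by
    rw [hG1, add_mulVec, smul_mulVec, one_mulVec, ← mulVec_mulVec]
    simp only [Pi.add_apply, Pi.smul_apply, Pi.one_apply, smul_eq_mul, r]
    congr 2
    change _ = A (Fin.last s) ⬝ᵥ (G *ᵥ 1)
    rw [hrow]
  have hMeq : M = vecMulVec (G *ᵥ 1) (Pi.single (Fin.last s) 1) := by
    have hcomm : A * G * A⁻¹ = G := by
      have h3 : A * (1 - z • A) = (1 - z • A) * A := by
        simp [mul_sub, sub_mul]
      calc A * G * A⁻¹ = G * ((1 - z • A) * A) * G * A⁻¹ := by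
            rw [← Matrix.mul_assoc G, hGl, Matrix.one_mul]
        _ = G * (A * (1 - z • A)) * G * A⁻¹ := by rw [h3]
        _ = G * A * ((1 - z • A) * G) * A⁻¹ := by simp only [Matrix.mul_assoc]
        _ = G := by rw [hGr, Matrix.mul_one, Matrix.mul_assoc, hIr, Matrix.mul_one]
    rw [hM, hD1, ← Matrix.mul_assoc, ← Matrix.mul_assoc, hcomm, mul_vecMulVec, vecMulVec_mul,
      hbA]
  have hstep : ∀ (B : Matrix (Fin (s + 1)) (Fin (s + 1)) ℂ),
      (M * B) (Fin.last s) = R.r z • B (Fin.last s) := by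
    intro B
    rw [hMeq, vecMulVec_mul, single_one_vecMul, hrG]
    funext j
    simp [vecMulVec_apply]
  induction n with
  | zero =>
    rw [e, hE, pow_zero, Matrix.one_mul, pow_zero, one_smul]
    funext j
    change A (Fin.last s) ⬝ᵥ _ = _
    rw [hrow]
    rfl
  | succ k ih =>
    rw [e, hE] at ih ⊢
    rw [pow_succ', Matrix.mul_assoc, hstep, ih, smul_smul, pow_succ']

end RungeKutta

/-- The `Q`-point Gauss--Jacobi rule with nodes `x` and weights `w`: the `Q`-point formula that is
exact, for the weight function `(1 + x)^(-α)` on `[-1, 1]`, on all polynomials of degree at most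
`2 Q - 1`. -/
def IsGaussJacobi (α : ℝ) {Q : ℕ} (x w : Fin Q → ℝ) : Prop :=
  ∀ p : Polynomial ℝ, p.natDegree < 2 * Q →
    ∑ j, w j * p.eval (x j) = ∫ y in (-1 : ℝ)..1, (1 + y) ^ (-α) * p.eval y

/-- `ϱ_max = 1 + 2b/(L₀h) + √((2b/(L₀h))² + 4b/(L₀h))`. -/
def rhoMax (b h L₀ : ℝ) : ℝ :=
  1 + 2 * b / (L₀ * h) + √((2 * b / (L₀ * h)) ^ 2 + 4 * b / (L₀ * h))

/-- `ϱ_opt = 4Q/(γTL₀) + √(1 + (4Q/(γTL₀))²)`. -/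
def rhoOpt (γ T L₀ : ℝ) (Q : ℕ) : ℝ :=
  4 * Q / (γ * T * L₀) + √(1 + (4 * Q / (γ * T * L₀)) ^ 2)

end

/-! Composed with a norming functional (`Seminorm.exists_dual_eq`), the integrand becomes a scalar
function, analytic and bounded by some `M` not only on a Bernstein ellipse but on the whole
half-plane `Re z ≥ -(ρ + ρ⁻¹) / 2`. This is because `r ^ n • q` is controlled on `Re z ≤ b`. Expand
the reflected function in Chebyshev polynomials; the rule is exact below degree `2Q`, so only the
tail of the series contributes to the error.

The standard estimates `2 M ρ⁻ᵏ` for the coefficients and `2 m` for the error on each polynomial,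
`m` being the mass of the weight, lose a factor 4 against the claim. The half-plane recovers it: the
Joukowski map sends the part of the unit disc outside the disc with diameter `[0, 1/ρ]` into `Re z ≤
(ρ + ρ⁻¹) / 2`, so the contour for a coefficient can be shrunk to that small circle. It is shorter
than `|v| = 1/ρ`, and `|v|²` averages to half its maximum on it; this gives `M / 2 * ρ⁻ᵏ` for `k ≥
3` (`exists_chebyshev_expansion`). For `k = 2` only `M * ρ⁻²` results; that degree matters only for
`Q = 1`, where the one-point rule is computed explicitly (`abs_error_chebyshev_two_le`). Summing the
geometric tail gives `norm_error_le`.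

It remains to choose `ρ`: either the near-minimizer `rhoOpt` of the bound, or `rhoMax`, for which
the half-plane reaches exactly `Re z = b`. -/

/-! ### Contour deformation under the Joukowski map -/

open Complex Set in
/-- Cauchy's theorem for the region between the unit circle and a circle
inside it, with centre on the real axis. -/
theorem circleIntegral_eq_of_differentiableAt_homotopy {g : ℂ → ℂ} {c r : ℝ}
    (hg : ∀ τ ∈ Icc (0 : ℝ) 1, ∀ θ : ℝ,
      DifferentiableAt ℂ g (circleMap ((τ * c : ℝ) : ℂ) (1 - τ * (1 - r)) θ)) :
    (∮ v in C(0, 1), g v) = ∮ v in C((c : ℂ), r), g v := by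
  -- `γ` is the homotopy in `(τ, θ)`; `a` and `b` are its derivatives in `τ` and `θ`.
  let γ : ℝ × ℝ → ℂ := fun p => ((p.1 * c : ℝ) : ℂ) + ((1 - p.1 * (1 - r) : ℝ) : ℂ) * exp (p.2 * I)
  let a : ℝ × ℝ → ℂ := fun p => c - (1 - r) * exp (p.2 * I)
  let b : ℝ × ℝ → ℂ := fun p => ((1 - p.1 * (1 - r) : ℝ) : ℂ) * (exp (p.2 * I) * I)
  have hγc : ∀ p, γ p = circleMap ((p.1 * c : ℝ) : ℂ) (1 - p.1 * (1 - r)) p.2 := fun p => rfl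
  let d1 : ℝ × ℝ →L[ℝ] ℂ := ofRealCLM.comp (ContinuousLinearMap.fst ℝ ℝ ℝ)
  let d2 : ℝ × ℝ →L[ℝ] ℂ := ofRealCLM.comp (ContinuousLinearMap.snd ℝ ℝ ℝ)
  have h1 : ∀ p : ℝ × ℝ, HasFDerivAt (fun p : ℝ × ℝ => ((p.1 : ℝ) : ℂ)) d1 p :=
    fun p => d1.hasFDerivAt
  have h2 : ∀ p : ℝ × ℝ, HasFDerivAt (fun p : ℝ × ℝ => ((p.2 : ℝ) : ℂ)) d2 p :=
    fun p => d2.hasFDerivAt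
  have hexp : ∀ p : ℝ × ℝ, HasFDerivAt (fun p : ℝ × ℝ => exp (p.2 * I))
      ((exp (p.2 * I) * I) • d2) p := by
    intro p
    have := ((h2 p).mul_const I).cexp
    refine this.congr_fderiv ?_
    ext <;> simp [d2, mul_comm]
  have hs : ∀ p : ℝ × ℝ, HasFDerivAt (fun p : ℝ × ℝ => ((1 - p.1 * (1 - r) : ℝ) : ℂ))
      ((-(1 - r : ℂ)) • d1) p := by
    intro p
    have := ((h1 p).mul_const (1 - r : ℂ)).const_sub 1
    refine (this.congr_of_eventuallyEq (.of_forall fun q => by push_cast; ring)).congr_fderiv ?_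
    ext <;> simp [d1]
  have hγ : ∀ p, HasFDerivAt γ (a p • d1 + b p • d2) p := by
    intro p
    have hc : HasFDerivAt (fun p : ℝ × ℝ => ((p.1 * c : ℝ) : ℂ)) ((c : ℂ) • d1) p := by
      have := (h1 p).mul_const (c : ℂ)
      exact (this.congr_of_eventuallyEq (.of_forall fun q => by push_cast; ring))
    refine (hc.add ((hs p).mul (hexp p))).congr_fderiv ?_
    ext <;> simp [a, b, d1, d2] <;> ring
  have ha : ∀ p, HasFDerivAt a ((-(1 - r : ℂ) * (exp (p.2 * I) * I)) • d2) p := by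
    intro p
    refine (((hexp p).const_mul (1 - r : ℂ)).const_sub (c : ℂ)).congr_fderiv ?_
    ext <;> simp [d2] <;> ring
  have hb : ∀ p, HasFDerivAt b ((-(1 - r : ℂ) * (exp (p.2 * I) * I)) • d1
      + (((1 - p.1 * (1 - r) : ℝ) : ℂ) * (exp (p.2 * I) * I * I)) • d2) p := by
    intro p
    refine ((hs p).mul ((hexp p).mul_const I)).congr_fderiv ?_
    ext <;> simp [-mul_eq_mul_left_iff, d1, d2] <;> ring
  have hgd : ∀ p ∈ Icc (0 : ℝ) 1 ×ˢ (univ : Set ℝ),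
      HasFDerivAt (fun p => g (γ p)) ((deriv g (γ p)) • (a p • d1 + b p • d2)) p := by
    rintro p ⟨hp, -⟩
    have := (hg p.1 hp p.2).hasDerivAt
    rw [← hγc] at this
    exact this.comp_hasFDerivAt_of_eq p (hγ p) rfl
  have hf : ∀ p ∈ Icc (0 : ℝ) 1 ×ˢ (univ : Set ℝ), HasFDerivAt (fun p => g (γ p) * b p) _ p :=
    fun p hp => (hgd p hp).mul (hb p)
  have hk : ∀ p ∈ Icc (0 : ℝ) 1 ×ˢ (univ : Set ℝ), HasFDerivAt (fun p => -(g (γ p) * a p)) _ p :=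
    fun p hp => ((hgd p hp).mul (ha p)).neg
  have hsub : ∀ p : ℝ × ℝ, p ∈ uIcc (0 : ℝ) 1 ×ˢ uIcc 0 (2 * Real.pi) →
      p ∈ Icc (0 : ℝ) 1 ×ˢ (univ : Set ℝ) := by
    rintro p ⟨hp, -⟩
    rw [uIcc_of_le zero_le_one] at hp
    exact ⟨hp, mem_univ _⟩
  have hsub' : ∀ p : ℝ × ℝ, p ∈ Ioo (min (0 : ℝ) 1) (max 0 1) ×ˢ
      Ioo (min 0 (2 * Real.pi)) (max 0 (2 * Real.pi)) →
      p ∈ Icc (0 : ℝ) 1 ×ˢ (univ : Set ℝ) := by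
    rintro p ⟨hp, -⟩
    simp only [zero_le_one, inf_of_le_left, sup_of_le_right] at hp
    exact ⟨Ioo_subset_Icc_self hp, mem_univ _⟩
  have key := MeasureTheory.integral2_divergence_prod_of_hasFDerivAt
    (fun p => g (γ p) * b p) (fun p => -(g (γ p) * a p)) _ _ 0 0 1 (2 * Real.pi)
    (fun p hp => (hf p (hsub p hp)).continuousAt.continuousWithinAt)
    (fun p hp => (hk p (hsub p hp)).continuousAt.continuousWithinAt)
    (fun p hp => hf p (hsub' p hp)) (fun p hp => hk p (hsub' p hp))
  -- The divergence vanishes: the mixed partials of `γ` agree and the two terms with `deriv g`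
  -- cancel.
  have hz : ∀ p : ℝ × ℝ, (g (γ p) • ((-(1 - r : ℂ) * (exp (p.2 * I) * I)) • d1
      + (((1 - p.1 * (1 - r) : ℝ) : ℂ) * (exp (p.2 * I) * I * I)) • d2)
      + b p • ((deriv g (γ p)) • (a p • d1 + b p • d2))) (1, 0)
      + (-(g (γ p) • ((-(1 - r : ℂ) * (exp (p.2 * I) * I)) • d2)
      + a p • ((deriv g (γ p)) • (a p • d1 + b p • d2)))) (0, 1) = 0 := by
    intro p
    simp [d1, d2]
    ring
  have key := key (by simp only [hz]; exact MeasureTheory.integrableOn_zero)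
  simp only [hz] at key
  have hper : ∀ t : ℝ, g (γ (t, 2 * Real.pi)) * a (t, 2 * Real.pi) = g (γ (t, 0)) * a (t, 0) := by
    intro t
    simp [γ, a]
  simp only [intervalIntegral.integral_zero, hper, sub_self, zero_add] at key
  simp only [circleIntegral, deriv_circleMap, smul_eq_mul]
  have := sub_eq_zero.mp key.symm
  refine (Eq.trans ?_ this.symm).trans ?_ <;> refine intervalIntegral.integral_congr fun θ _ => ?_
  · simp [γ, b, circleMap, mul_comm]
  · simp only [γ, b, circleMap]
    push_cast
    ring_nf

theorem add_inv_le_add_inv {x y : ℝ} (hx : 1 ≤ x) (hxy : x ≤ y) : x + x⁻¹ ≤ y + y⁻¹ := by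
  have hx0 : 0 < x := by linarith
  have hy0 : 0 < y := by linarith
  have h1 : y + y⁻¹ - (x + x⁻¹) = (y - x) * (x * y - 1) / (x * y) := by
    field_simp
    ring
  have h2 : 0 ≤ (y - x) * (x * y - 1) / (x * y) :=
    div_nonneg (mul_nonneg (by linarith) (by nlinarith)) (by positivity)
  linarith

open Complex Set in
/-- The Joukowski map sends the unit disc minus the disc with diameter `[0, 1/ϱ]`
into a half-plane. -/
theorem re_joukowski_le {ρ : ℝ} (hρ : 1 < ρ) {v : ℂ} (h0 : v ≠ 0) (h1 : ‖v‖ ≤ 1)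
    (h2 : 1 / (2 * ρ) ≤ ‖v - ((1 / (2 * ρ) : ℝ) : ℂ)‖) :
    ((v + v⁻¹) / 2).re ≤ (ρ + ρ⁻¹) / 2 := by
  have hρ0 : 0 < ρ := by linarith
  set n := normSq v with hn
  have hn0 : 0 < n := normSq_pos.mpr h0
  have hn1 : n ≤ 1 := by
    rw [hn, normSq_eq_norm_sq]
    exact pow_le_one₀ (norm_nonneg _) h1
  have ha : v.re ^ 2 ≤ n := by
    rw [hn, normSq_apply]
    nlinarith [sq_nonneg v.im]
  -- Lying outside the small disc means exactly `Re v⁻¹ ≤ ρ`.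
  have hb : v.re ≤ ρ * n := by
    have h3 : (1 / (2 * ρ)) ^ 2 ≤ ‖v - ((1 / (2 * ρ) : ℝ) : ℂ)‖ ^ 2 :=
      pow_le_pow_left₀ (by positivity) h2 2
    rw [← normSq_eq_norm_sq, normSq_apply] at h3
    simp only [sub_re, sub_im, ofReal_re, ofReal_im, sub_zero] at h3
    have h4 : 2 * (1 / (2 * ρ)) * v.re ≤ n := by
      rw [hn, normSq_apply]
      nlinarith
    have h5 : 2 * (1 / (2 * ρ)) * v.re = v.re / ρ := by field_simp
    rw [h5, div_le_iff₀ hρ0] at h4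
    linarith
  have hre : ((v + v⁻¹) / 2).re = (v.re + v.re / n) / 2 := by
    have : (v + v⁻¹) / 2 = (((1 / 2 : ℝ) : ℂ)) * (v + v⁻¹) := by push_cast; ring
    rw [this, re_ofReal_mul, add_re, inv_re]
    ring
  rw [hre]
  have hρi : 0 < ρ⁻¹ := by positivity
  have hρm : ρ * ρ⁻¹ = 1 := mul_inv_cancel₀ hρ0.ne'
  -- With `x = Re v⁻¹`, the real part of the image is `(x * n + x) / 2`. For `x > 1`, `x ^ 2 * n ≤
  -- 1` bounds it by `(x⁻¹ + x) / 2`; for `x ≤ 1`, it is at most 1.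
  set x := v.re / n with hx
  have hxn : v.re = x * n := by rw [hx]; field_simp
  have hxρ : x ≤ ρ := by rw [hx, div_le_iff₀ hn0]; exact hb
  rw [hxn] at ha ⊢
  have hx2 : x ^ 2 * n ≤ 1 := by
    by_contra hcon
    nlinarith
  have h2ρ : 2 ≤ ρ + ρ⁻¹ := by nlinarith [sq_nonneg (ρ - 1)]
  rcases le_or_gt x 1 with hx1 | hx1
  · rcases le_or_gt x 0 with hx0 | hx0
    · nlinarith
    · nlinarith
  · have h6 : x * n ≤ x⁻¹ := by
      rw [← one_div, le_div_iff₀ (by linarith)]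
      nlinarith
    have h7 := add_inv_le_add_inv hx1.le hxρ
    linarith

-- Triangle inequality between centres. The rightmost point of each intermediate circle is `1 - τ *
-- (1 - 1 / ρ)`, which moves from `1` to `1 / ρ`. Taking `c` strictly below `1 / (2 * ρ)` keeps `0`
-- strictly inside every circle.
open Complex Set in
theorem circleMap_mem_of_homotopy {ρ c τ : ℝ} (hρ : 1 < ρ) (hc0 : 0 < c) (hc : c < 1 / (2 * ρ))
    (hτ : τ ∈ Icc (0 : ℝ) 1) (θ : ℝ) :
    let v := circleMap ((τ * c : ℝ) : ℂ) (1 - τ * (1 - (1 / ρ - c))) θ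
    v ≠ 0 ∧ ‖v‖ ≤ 1 ∧ 1 / (2 * ρ) ≤ ‖v - ((1 / (2 * ρ) : ℝ) : ℂ)‖ := by
  intro v
  obtain ⟨h0, h1⟩ := hτ
  have hρ0 : 0 < ρ := by linarith
  set i := 1 / (2 * ρ) with hi
  have hi2 : 1 / ρ = 2 * i := by rw [hi]; field_simp
  have hi0 : 0 < i := by positivity
  have hi1 : 2 * i < 1 := by rw [← hi2, div_lt_one hρ0]; exact hρ
  have hR : 0 < 1 - τ * (1 - (2 * i - c)) - τ * c := by nlinarith
  have hτc : 0 ≤ τ * c := by positivity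
  have hτi : τ * c ≤ i := by nlinarith
  have hnorm : ∀ a : ℝ, ‖v - (a : ℂ)‖ ≤ (1 - τ * (1 - (2 * i - c))) + |τ * c - a| ∧
      (1 - τ * (1 - (2 * i - c))) - |τ * c - a| ≤ ‖v - (a : ℂ)‖ := by
    intro a
    have e : v - (a : ℂ) = circleMap 0 (1 - τ * (1 - (2 * i - c))) θ + ((τ * c - a : ℝ) : ℂ) := by
      simp only [v, circleMap, hi2]
      push_cast
      ring
    have e1 : ‖circleMap 0 (1 - τ * (1 - (2 * i - c))) θ‖ = 1 - τ * (1 - (2 * i - c)) := by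
      rw [norm_circleMap_zero, abs_of_pos (by linarith)]
    have e2 : ‖((τ * c - a : ℝ) : ℂ)‖ = |τ * c - a| := by rw [norm_real, Real.norm_eq_abs]
    rw [e]
    refine ⟨(norm_add_le _ _).trans (by rw [e1, e2]), ?_⟩
    have := norm_sub_norm_le (circleMap 0 (1 - τ * (1 - (2 * i - c))) θ)
      (-((τ * c - a : ℝ) : ℂ))
    rw [sub_neg_eq_add, norm_neg, e1, e2] at this
    exact this
  have n0 := hnorm 0
  rw [ofReal_zero, sub_zero, sub_zero, abs_of_nonneg hτc] at n0
  refine ⟨norm_pos_iff.mp (by linarith), by nlinarith, ?_⟩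
  have n1 := (hnorm i).2
  rw [abs_of_nonpos (by linarith)] at n1
  refine le_trans ?_ n1
  nlinarith

open Complex Set in
/-- A Chebyshev coefficient, as a circle integral over a circle through `1/ϱ`. -/
theorem circleIntegral_joukowski_eq {f : ℂ → ℂ} {ρ c : ℝ} (hρ : 1 < ρ)
    (hf : ∀ z : ℂ, z.re ≤ (ρ + ρ⁻¹) / 2 → DifferentiableAt ℂ f z)
    (hc0 : 0 < c) (hc : c < 1 / (2 * ρ)) (k : ℕ) :
    (∮ v in C(0, 1), f ((v + v⁻¹) / 2) * v ^ k)
      = ∮ v in C((c : ℂ), 1 / ρ - c), f ((v + v⁻¹) / 2) * v ^ k := by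
  apply circleIntegral_eq_of_differentiableAt_homotopy
  intro τ hτ θ
  obtain ⟨h0, h1, h2⟩ := circleMap_mem_of_homotopy hρ hc0 hc hτ θ
  set v := circleMap ((τ * c : ℝ) : ℂ) (1 - τ * (1 - (1 / ρ - c))) θ
  have hd := hf _ (re_joukowski_le hρ h0 h1 h2)
  have hj : DifferentiableAt ℂ (fun v : ℂ => (v + v⁻¹) / 2) v :=
    (differentiableAt_id.add (differentiableAt_inv h0)).div_const 2
  exact (hd.comp v hj).mul (differentiableAt_id.pow k)

-- The cross term is a multiple of `cos θ`, which has mean zero. At `r = c` this mean is half of the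
-- maximum `(r + c) ^ 2`, which supplies the last factor 2 in the coefficient bound.
open Complex Set in
theorem integral_norm_circleMap_sq (c r : ℝ) :
    ∫ θ in (0 : ℝ)..2 * Real.pi, ‖circleMap (c : ℂ) r θ‖ ^ 2
      = 2 * Real.pi * (r ^ 2 + c ^ 2) := by
  have : ∀ θ : ℝ, ‖circleMap (c : ℂ) r θ‖ ^ 2 = (r ^ 2 + c ^ 2) + 2 * r * c * Real.cos θ := by
    intro θ
    rw [← normSq_eq_norm_sq, normSq_apply, circleMap, exp_mul_I, ← ofReal_cos, ← ofReal_sin]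
    simp only [add_re, add_im, ofReal_re, ofReal_im, mul_re, mul_im,
      I_re, I_im]
    linear_combination r ^ 2 * Real.sin_sq_add_cos_sq θ
  simp only [this]
  rw [intervalIntegral.integral_add (by simp)
    ((Continuous.intervalIntegrable (by fun_prop) _ _)), intervalIntegral.integral_const_mul]
  simp [-mul_eq_mul_left_iff]
  ring

open Complex Set Filter Topology in
/-- Chebyshev coefficients of a function bounded on a half-plane. -/
theorem norm_circleIntegral_joukowski_le {f : ℂ → ℂ} {ρ M : ℝ} (hρ : 1 < ρ)
    (hf : ∀ z : ℂ, z.re ≤ (ρ + ρ⁻¹) / 2 → DifferentiableAt ℂ f z)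
    (hM : ∀ z : ℂ, z.re ≤ (ρ + ρ⁻¹) / 2 → ‖f z‖ ≤ M) :
    ‖∮ v in C(0, 1), f ((v + v⁻¹) / 2) * v ^ 1‖ ≤ 2 * Real.pi * (M / 2 * (ρ⁻¹) ^ 2) ∧
    ∀ k : ℕ, ‖∮ v in C(0, 1), f ((v + v⁻¹) / 2) * v ^ (k + 2)‖
      ≤ 2 * Real.pi * (M / 4 * (ρ⁻¹) ^ (k + 3)) := by
  have hρ0 : 0 < ρ := by linarith
  have hM0 : 0 ≤ M := (norm_nonneg _).trans (hM 0 (by simp; positivity))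
  -- The limiting circle passes through the singularity `0`, so the estimates are made for smaller
  -- `c` and then passed to the limit.
  have hlim : Tendsto (fun c : ℝ => c) (𝓝[<] (1 / (2 * ρ))) (𝓝 (1 / (2 * ρ))) :=
    tendsto_id.mono_left nhdsWithin_le_nhds
  have hev : ∀ᶠ c : ℝ in 𝓝[<] (1 / (2 * ρ)), 0 < c ∧ c < 1 / (2 * ρ) :=
    Ioo_mem_nhdsLT (by positivity)
  have hmem : ∀ c : ℝ, 0 < c → c < 1 / (2 * ρ) → ∀ θ : ℝ,
      ‖f ((circleMap (c : ℂ) (1 / ρ - c) θ + (circleMap (c : ℂ) (1 / ρ - c) θ)⁻¹) / 2)‖ ≤ M ∧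
      0 < 1 / ρ - c ∧ ‖circleMap (c : ℂ) (1 / ρ - c) θ‖ ≤ ρ⁻¹ := by
    intro c hc0 hc θ
    obtain ⟨h0, h1, h2⟩ := circleMap_mem_of_homotopy hρ hc0 hc
      (right_mem_Icc.mpr zero_le_one) θ
    simp only [one_mul, sub_sub_cancel] at h0 h1 h2
    have hr : 0 < 1 / ρ - c := by
      have : 1 / ρ = 2 * (1 / (2 * ρ)) := by field_simp
      linarith
    refine ⟨hM _ (re_joukowski_le hρ h0 h1 h2), hr, ?_⟩
    rw [circleMap, ← circleMap_zero]
    refine (norm_add_le _ _).trans ?_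
    rw [norm_circleMap_zero, abs_of_pos hr, norm_real, Real.norm_eq_abs, abs_of_pos hc0]
    simp
  constructor
  · have h1 : ∀ᶠ c : ℝ in 𝓝[<] (1 / (2 * ρ)), ‖∮ v in C(0, 1), f ((v + v⁻¹) / 2) * v ^ 1‖
        ≤ 2 * Real.pi * (1 / ρ - c) * (M * ρ⁻¹) := by
      filter_upwards [hev] with c hc
      rw [circleIntegral_joukowski_eq hρ hf hc.1 hc.2]
      refine circleIntegral.norm_integral_le_of_norm_le_const (hmem c hc.1 hc.2 0).2.1.le ?_
      intro v hv
      rw [← abs_of_pos (hmem c hc.1 hc.2 0).2.1, ← range_circleMap] at hv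
      obtain ⟨θ, rfl⟩ := hv
      rw [norm_mul, pow_one]
      exact mul_le_mul (hmem c hc.1 hc.2 θ).1 (hmem c hc.1 hc.2 θ).2.2 (norm_nonneg _) hM0
    have h2 : Tendsto (fun c : ℝ => 2 * Real.pi * (1 / ρ - c) * (M * ρ⁻¹)) (𝓝[<] (1 / (2 * ρ)))
        (𝓝 (2 * Real.pi * (1 / ρ - 1 / (2 * ρ)) * (M * ρ⁻¹))) :=
      ((hlim.const_sub _).const_mul _).mul_const _
    refine (ge_of_tendsto h2 h1).trans (le_of_eq ?_)
    field_simp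
    ring
  -- Two powers of `v` are reserved for the mean of `|v|²`; the other `k` are bounded by `ρ⁻¹`.
  · intro k
    have h1 : ∀ᶠ c : ℝ in 𝓝[<] (1 / (2 * ρ)),
        ‖∮ v in C(0, 1), f ((v + v⁻¹) / 2) * v ^ (k + 2)‖
        ≤ (1 / ρ - c) * (M * ρ⁻¹ ^ k) * (2 * Real.pi * ((1 / ρ - c) ^ 2 + c ^ 2)) := by
      filter_upwards [hev] with c hc
      rw [circleIntegral_joukowski_eq hρ hf hc.1 hc.2, ← integral_norm_circleMap_sq,
        ← intervalIntegral.integral_const_mul, circleIntegral]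
      refine intervalIntegral.norm_integral_le_of_norm_le Real.two_pi_pos.le
        (.of_forall fun θ _ => ?_) (Continuous.intervalIntegrable (by fun_prop) _ _)
      obtain ⟨ha, hb, hd⟩ := hmem c hc.1 hc.2 θ
      have e1 : ‖deriv (circleMap (c : ℂ) (1 / ρ - c)) θ‖ = 1 / ρ - c := by
        simp [deriv_circleMap, -one_div, abs_of_pos hb]
      rw [norm_smul, e1, norm_mul, norm_pow, pow_add, mul_assoc, mul_assoc (M : ℝ) _ _]
      gcongr
    have h2 : Tendsto (fun c : ℝ => (1 / ρ - c) * (M * ρ⁻¹ ^ k) *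
        (2 * Real.pi * ((1 / ρ - c) ^ 2 + c ^ 2))) (𝓝[<] (1 / (2 * ρ)))
        (𝓝 ((1 / ρ - 1 / (2 * ρ)) * (M * ρ⁻¹ ^ k) *
        (2 * Real.pi * ((1 / ρ - 1 / (2 * ρ)) ^ 2 + (1 / (2 * ρ)) ^ 2)))) :=
      ((hlim.const_sub _).mul_const _).mul ((((hlim.const_sub _).pow 2).add (hlim.pow 2)).const_mul _)
    refine (ge_of_tendsto h2 h1).trans (le_of_eq ?_)
    rw [pow_add]
    field_simp
    ring

/-! ### Chebyshev expansion -/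

open Complex Set Polynomial in
/-- The Chebyshev expansion of a function that is bounded on a half-plane containing the
Bernstein ellipse with parameter `ϱ`. -/
theorem exists_chebyshev_expansion {f : ℂ → ℂ} {ρ M : ℝ} (hρ : 1 < ρ)
    (hf : ∀ z : ℂ, z.re ≤ (ρ + ρ⁻¹) / 2 → DifferentiableAt ℂ f z)
    (hM : ∀ z : ℂ, z.re ≤ (ρ + ρ⁻¹) / 2 → ‖f z‖ ≤ M) :
    ∃ a : ℕ → ℂ, ‖a 2‖ ≤ M * ρ⁻¹ ^ 2 ∧ (∀ k, 3 ≤ k → ‖a k‖ ≤ M / 2 * ρ⁻¹ ^ k) ∧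
      ∀ x ∈ Icc (-1 : ℝ) 1,
        HasSum (fun k : ℕ => a k * (((Chebyshev.T ℝ k).eval x : ℝ) : ℂ)) (f x) := by
  have hρ0 : 0 < ρ := by linarith
  have : Fact (0 < 2 * Real.pi) := ⟨Real.two_pi_pos⟩
  have hd : 1 ≤ (ρ + ρ⁻¹) / 2 := by
    have : ρ * ρ⁻¹ = 1 := mul_inv_cancel₀ hρ0.ne'
    have : 0 < ρ⁻¹ := by positivity
    nlinarith [sq_nonneg (ρ - 1)]
  have hre : ∀ t : AddCircle (2 * Real.pi), (AddCircle.toCircle t : ℂ).re ≤ 1 := fun t =>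
    (re_le_norm _).trans (Circle.norm_coe _).le
  let G : C(AddCircle (2 * Real.pi), ℂ) :=
    ⟨fun t => f (((AddCircle.toCircle t : ℂ).re : ℝ) : ℂ), by
      refine continuous_iff_continuousAt.mpr fun t => ?_
      have h1 := (hf (((AddCircle.toCircle t : ℂ).re : ℝ) : ℂ)
        (by rw [ofReal_re]; exact (hre t).trans hd)).continuousAt
      have h2 : Continuous fun t : AddCircle (2 * Real.pi) =>
          (((AddCircle.toCircle t : ℂ).re : ℝ) : ℂ) :=
        continuous_ofReal.comp (continuous_re.comp
          (continuous_subtype_val.comp AddCircle.continuous_toCircle))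
      exact ContinuousAt.comp (f := fun t : AddCircle (2 * Real.pi) =>
          (((AddCircle.toCircle t : ℂ).re : ℝ) : ℂ)) h1 h2.continuousAt⟩
  have hmk : ∀ θ : ℝ, (AddCircle.toCircle (θ : AddCircle (2 * Real.pi)) : ℂ) = exp (θ * I) := by
    intro θ
    rw [AddCircle.toCircle_apply_mk, Circle.coe_exp]
    congr 2
    push_cast
    field_simp
  have hG : ∀ θ : ℝ, G (θ : AddCircle (2 * Real.pi)) = f ((Real.cos θ : ℝ) : ℂ) := by
    intro θ
    change f _ = _
    rw [hmk, exp_ofReal_mul_I_re]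
  have hsymm : ∀ n : ℤ, fourierCoeff G (-n) = fourierCoeff G n := by
    intro n
    rw [fourierCoeff, fourierCoeff, ← MeasureTheory.integral_neg_eq_self]
    refine MeasureTheory.integral_congr_ae (.of_forall fun t => ?_)
    have h1 : G (-t) = G t := by
      change f _ = f _
      rw [AddCircle.toCircle_neg, Circle.coe_inv_eq_conj, conj_re]
    have h2 : fourier (- -n) (-t) = fourier (-n) t := by
      simp [fourier_apply]
    simp only [h1, h2]
  -- By symmetry the coefficient of index `-(k + 1)` may be used instead, which has `v ^ (k + 1)` in
  -- the integrand; one power goes into `dv = i v dθ`.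
  have hcoeff : ∀ k : ℕ, fourierCoeff G (k + 1 : ℕ)
      = (2 * Real.pi * I)⁻¹ * ∮ v in C(0, 1), f ((v + v⁻¹) / 2) * v ^ k := by
    intro k
    rw [← hsymm, fourierCoeff_eq_intervalIntegral _ _ 0, circleIntegral, real_smul, mul_inv,
      mul_assoc, zero_add]
    push_cast
    rw [one_div]
    congr 1
    rw [← intervalIntegral.integral_const_mul]
    refine intervalIntegral.integral_congr fun θ _ => ?_
    have h1 : (circleMap 0 1 θ + (circleMap 0 1 θ)⁻¹) / 2 = ((Real.cos θ : ℝ) : ℂ) := by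
      rw [circleMap, ofReal_cos, Complex.cos]
      simp [← exp_neg]
    simp only [hG, fourier_apply, neg_neg, AddCircle.toCircle_zsmul, Circle.coe_zpow, hmk, h1,
      smul_eq_mul, deriv_circleMap]
    rw [circleMap]
    have h2 : I ≠ 0 := I_ne_zero
    simp only [ofReal_one, one_mul, zero_add]
    rw [show ((k : ℤ) + 1) = ((k + 1 : ℕ) : ℤ) by push_cast; rfl, zpow_natCast]
    field_simp
    ring
  have hnorm : ∀ B : ℝ, ∀ k : ℕ, ‖∮ v in C(0, 1), f ((v + v⁻¹) / 2) * v ^ k‖ ≤ 2 * Real.pi * B →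
      ‖fourierCoeff G (k + 1 : ℕ)‖ ≤ B := by
    intro B k h
    rw [hcoeff, norm_mul, norm_inv, inv_mul_le_iff₀ (by simp)]
    simpa [abs_of_pos Real.pi_pos] using h
  obtain ⟨hc2, hc3⟩ := norm_circleIntegral_joukowski_le hρ hf hM
  have hb2 : ‖fourierCoeff G (2 : ℕ)‖ ≤ M / 2 * ρ⁻¹ ^ 2 := hnorm _ 1 hc2
  have hb3 : ∀ k : ℕ, ‖fourierCoeff G (k + 3 : ℕ)‖ ≤ M / 4 * ρ⁻¹ ^ (k + 3) := fun k =>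
    hnorm _ (k + 2) (hc3 k)
  have hsN : Summable fun k : ℕ => fourierCoeff G (k : ℤ) := by
    refine (summable_nat_add_iff 3).mp (Summable.of_norm_bounded ?_ hb3)
    refine Summable.mul_left _ ((summable_nat_add_iff 3).mpr ?_)
    exact summable_geometric_of_lt_one (by positivity) (inv_lt_one_of_one_lt₀ hρ)
  have hsum : Summable (fourierCoeff G) :=
    Summable.of_nat_of_neg hsN (by simpa only [hsymm] using hsN)
  -- Pairing the indices `k` and `-k` doubles each coefficient and counts index 0 twice; the
  -- correction removes one copy.
  refine ⟨fun k => 2 * fourierCoeff G k - if k = 0 then fourierCoeff G 0 else 0, ?_, ?_, ?_⟩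
  · simp only [OfNat.ofNat_ne_zero, if_false, sub_zero, norm_mul, RCLike.norm_ofNat]
    linarith
  · intro k hk
    obtain ⟨j, rfl⟩ := Nat.exists_eq_add_of_le' hk
    have := hb3 j
    simp only [Nat.add_eq_zero_iff, OfNat.ofNat_ne_zero, and_false, if_false, sub_zero, norm_mul,
      RCLike.norm_ofNat]
    linarith
  · intro x hx
    have h1 := (has_pointwise_sum_fourier_series_of_summable hsum
      ((Real.arccos x : ℝ) : AddCircle (2 * Real.pi))).nat_add_neg
    have h2 := h1.sub (hasSum_ite_eq (0 : ℕ) (fourierCoeff G 0))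
    rw [hG, Real.cos_arccos hx.1 hx.2] at h2
    simp only [fourier_zero, smul_eq_mul, mul_one, add_sub_cancel_right] at h2
    refine h2.congr_fun fun k => ?_
    have h3 : (((Chebyshev.T ℝ k).eval x : ℝ) : ℂ)
        = (exp (k * (Real.arccos x * I)) + exp (-(k * (Real.arccos x * I)))) / 2 := by
      rw [← Real.cos_arccos hx.1 hx.2, Chebyshev.T_real_cos, Real.cos_arccos hx.1 hx.2,
        ofReal_cos, Complex.cos]
      push_cast
      ring_nf
    have h4 : ∀ n : ℤ, fourier n ((Real.arccos x : ℝ) : AddCircle (2 * Real.pi))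
        = exp (n * (Real.arccos x * I)) := by
      intro n
      rw [fourier_apply, AddCircle.toCircle_zsmul, Circle.coe_zpow, hmk, ← exp_int_mul]
    simp only [h4, hsymm]
    by_cases hk : k = 0
    · subst hk
      simp
      ring
    · simp only [hk, if_false, sub_zero]
      rw [h3]
      push_cast
      rw [neg_mul]
      ring

/-! ### Gauss–Jacobi rules and their error -/

section GaussJacobi

open Set Polynomial MeasureTheory

theorem integral_one_add_rpow {β : ℝ} (hβ : -1 < β) :
    ∫ y in (-1 : ℝ)..1, (1 + y) ^ β = 2 ^ (β + 1) / (β + 1) := by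
  rw [intervalIntegral.integral_comp_add_left (fun t : ℝ => t ^ β) 1, integral_rpow (Or.inl hβ)]
  norm_num
  rw [Real.zero_rpow (by linarith), sub_zero]

theorem intervalIntegrable_one_add_rpow {β : ℝ} (hβ : -1 < β) :
    IntervalIntegrable (fun y : ℝ => (1 + y) ^ β) volume (-1) 1 := by
  have := (intervalIntegral.intervalIntegrable_rpow' (a := 0) (b := 2) hβ).comp_add_left 1
  norm_num at this
  exact this

theorem intervalIntegrable_jacobi_smul {α : ℝ} (hα : α < 1) {E : Type*} [NormedAddCommGroup E]
    [NormedSpace ℝ E] {g : ℝ → E} (hg : ContinuousOn g (Icc (-1) 1)) :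
    IntervalIntegrable (fun y => (1 + y) ^ (-α) • g y) volume (-1) 1 := by
  apply (intervalIntegrable_one_add_rpow (by linarith)).smul_continuousOn
  rwa [uIcc_of_le (by norm_num)]

/-- The integrand is nonnegative and, on `(-1, 1]`, vanishes only at the finitely many roots of `p`.
-/
theorem integral_jacobi_pos {α : ℝ} (hα : α < 1) {p : ℝ[X]} (hp : p ≠ 0)
    (hpos : ∀ y ∈ Icc (-1 : ℝ) 1, 0 ≤ p.eval y) :
    0 < ∫ y in (-1 : ℝ)..1, (1 + y) ^ (-α) * p.eval y := by
  have hint : IntervalIntegrable (fun y => (1 + y) ^ (-α) * p.eval y) volume (-1) 1 :=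
    intervalIntegrable_jacobi_smul hα p.continuous.continuousOn
  rw [intervalIntegral.integral_pos_iff_support_of_nonneg_ae' _ hint]
  · refine ⟨by norm_num, ?_⟩
    have h1 : Ioc (-1 : ℝ) 1 \ (p.roots.toFinset : Set ℝ) ⊆
        Function.support (fun y => (1 + y) ^ (-α) * p.eval y) ∩ Ioc (-1) 1 := by
      rintro y ⟨hy, hr⟩
      refine ⟨mul_ne_zero (Real.rpow_pos_of_pos (by linarith [hy.1]) _).ne' fun h0 => hr ?_, hy⟩
      simp [hp, h0]
    refine lt_of_lt_of_le ?_ (measure_mono h1)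
    rw [measure_sdiff_null (Finset.measure_zero _ _)]
    simp
  · rw [uIoc_of_le (by norm_num)]
    filter_upwards [ae_restrict_mem measurableSet_Ioc] with y hy
    exact mul_nonneg (Real.rpow_nonneg (by linarith [hy.1]) _) (hpos y ⟨hy.1.le, hy.2⟩)

namespace IsGaussJacobi

variable {α : ℝ} {Q : ℕ} {x w : Fin Q → ℝ}

theorem sum_weights (hxw : IsGaussJacobi α x w) (hα : α < 1) (hQ : 1 ≤ Q) :
    ∑ j, w j = 2 ^ (1 - α) / (1 - α) := by
  have h := hxw 1 (by rw [natDegree_one]; omega)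
  simp only [eval_one, mul_one] at h
  rw [h, integral_one_add_rpow (by linarith), neg_add_eq_sub]

/-- Testing a Gauss--Jacobi rule on the square of a node polynomial with one node left out,
times a factor of degree at most one. -/
theorem weight_mul_pos (hxw : IsGaussJacobi α x w) (hα : α < 1) (j : Fin Q) {l : ℝ[X]}
    (hl : l ≠ 0) (hdeg : l.natDegree ≤ 1) (hpos : ∀ y ∈ Icc (-1 : ℝ) 1, 0 ≤ l.eval y) :
    0 < w j * l.eval (x j) := by
  set p : ℝ[X] := ∏ i ∈ Finset.univ.erase j, (X - C (x i)) with hp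
  have hp0 : p ≠ 0 := Finset.prod_ne_zero_iff.mpr fun i _ => X_sub_C_ne_zero _
  have hpd : p.natDegree = Q - 1 := by
    rw [hp, natDegree_prod_of_monic _ _ fun i _ => monic_X_sub_C _]
    simp
  have hQ := j.pos
  -- The degree is at most `2 * (Q - 1) + 1`, just within exactness. Distinct nodes need not be
  -- assumed: a repeated node would make the sum zero.
  have hd : (p ^ 2 * l).natDegree < 2 * Q := by
    refine natDegree_mul_le.trans_lt ?_
    rw [natDegree_pow, hpd]
    omega
  have h := hxw _ hd
  have hI := integral_jacobi_pos hα (mul_ne_zero (pow_ne_zero 2 hp0) hl) fun y hy => by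
    rw [eval_mul, eval_pow]
    exact mul_nonneg (sq_nonneg _) (hpos y hy)
  rw [← h, Finset.sum_eq_single j] at hI
  · rw [eval_mul, eval_pow, mul_left_comm] at hI
    exact pos_of_mul_pos_right hI (sq_nonneg _)
  · intro i _ hij
    have : p.eval (x i) = 0 := by
      rw [hp, eval_prod]
      exact Finset.prod_eq_zero (Finset.mem_erase.mpr ⟨hij, Finset.mem_univ i⟩) (by simp)
    simp [this]
  · simp

theorem weight_pos (hxw : IsGaussJacobi α x w) (hα : α < 1) (j : Fin Q) : 0 < w j := by
  simpa using hxw.weight_mul_pos hα j one_ne_zero (by simp) (by simp)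

/-- Test with the factors `1 + X` and `1 - X` and divide by the positive weight. -/
theorem node_mem (hxw : IsGaussJacobi α x w) (hα : α < 1) (j : Fin Q) :
    x j ∈ Icc (-1 : ℝ) 1 := by
  have hw := hxw.weight_pos hα j
  have h1 := hxw.weight_mul_pos hα j (l := X + C 1) (X_add_C_ne_zero _) (natDegree_X_add_C _).le
    fun y hy => by simpa using by linarith [hy.1]
  have h2 := hxw.weight_mul_pos hα j (l := -(X - C 1)) (neg_ne_zero.mpr (X_sub_C_ne_zero _))
    (by rw [natDegree_neg, natDegree_X_sub_C]) fun y hy => by simpa using hy.2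
  have h1 := pos_of_mul_pos_right h1 hw.le
  have h2 := pos_of_mul_pos_right h2 hw.le
  simp only [eval_add, eval_sub, eval_neg, eval_X, eval_C] at h1 h2
  exact ⟨by linarith, by linarith⟩

/-- Since the weights are positive, the sum and the integral are each bounded by the mass of the
weight function. -/
theorem abs_error_le (hxw : IsGaussJacobi α x w) (hα : α < 1) (hQ : 1 ≤ Q) {p : ℝ[X]}
    (hp : ∀ y ∈ Icc (-1 : ℝ) 1, |p.eval y| ≤ 1) :
    |∑ j, w j * p.eval (x j) - ∫ y in (-1 : ℝ)..1, (1 + y) ^ (-α) * p.eval y|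
      ≤ 2 * (2 ^ (1 - α) / (1 - α)) := by
  have h1 : |∑ j, w j * p.eval (x j)| ≤ 2 ^ (1 - α) / (1 - α) := by
    rw [← hxw.sum_weights hα hQ]
    refine (Finset.abs_sum_le_sum_abs _ _).trans (Finset.sum_le_sum fun j _ => ?_)
    rw [abs_mul, abs_of_pos (hxw.weight_pos hα j)]
    exact mul_le_of_le_one_right (hxw.weight_pos hα j).le (hp _ (hxw.node_mem hα j))
  have h2 : |∫ y in (-1 : ℝ)..1, (1 + y) ^ (-α) * p.eval y| ≤ 2 ^ (1 - α) / (1 - α) := by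
    rw [← neg_add_eq_sub α 1, ← integral_one_add_rpow (by linarith), ← Real.norm_eq_abs]
    refine intervalIntegral.norm_integral_le_of_norm_le (by norm_num) (.of_forall fun y hy => ?_)
      (intervalIntegrable_one_add_rpow (by linarith))
    have hy0 : 0 ≤ (1 + y) ^ (-α) := Real.rpow_nonneg (by linarith [hy.1]) _
    rw [norm_mul, Real.norm_of_nonneg hy0]
    exact mul_le_of_le_one_right hy0 (hp y ⟨hy.1.le, hy.2⟩)
  refine (norm_sub_le (_ : ℝ) _).trans ?_
  rw [Real.norm_eq_abs, Real.norm_eq_abs]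
  linarith

/-- The one-point rule integrates a quadratic polynomial with an error that is twice the
variance of the normalized weight. -/
theorem abs_error_chebyshev_two_le {x w : Fin 1 → ℝ} (hxw : IsGaussJacobi α x w) (hα : α < 1)
    {p : ℝ[X]} (hp : p = 2 * (1 + X) ^ 2 - 4 * (1 + X) + 1) :
    |∑ j, w j * p.eval (x j) - ∫ y in (-1 : ℝ)..1, (1 + y) ^ (-α) * p.eval y|
      ≤ 2 ^ (1 - α) / (1 - α) := by
  -- The moments are explicit in powers of `1 + y`, which is why `p`, equal to `2 * X ^ 2 - 1`, is
  -- expanded in them.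
  have hpw : ∀ k : ℕ, ∫ y in (-1 : ℝ)..1, (1 + y) ^ (-α) * (1 + y) ^ k
      = 2 ^ (1 - α) * 2 ^ k / (1 - α + k) := by
    intro k
    have h1 : ∫ y in (-1 : ℝ)..1, (1 + y) ^ (-α) * (1 + y) ^ k
        = ∫ y in (-1 : ℝ)..1, (1 + y) ^ (-α + k) := by
      refine intervalIntegral.integral_congr_ae (.of_forall fun y hy => ?_)
      rw [uIoc_of_le (by norm_num)] at hy
      rw [Real.rpow_add_natCast (by linarith [hy.1])]
    have hk : (0 : ℝ) ≤ k := k.cast_nonneg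
    rw [h1, integral_one_add_rpow (by linarith), ← Real.rpow_natCast 2 k,
      ← Real.rpow_add two_pos]
    ring_nf
  have hi : ∀ k : ℕ, IntervalIntegrable (fun y : ℝ => (1 + y) ^ (-α) * (1 + y) ^ k)
      volume (-1) 1 := fun k =>
    intervalIntegrable_jacobi_smul hα (by fun_prop : ContinuousOn (fun y : ℝ => (1 + y) ^ k) _)
  have e0 := hxw 1 (by simp)
  have e1 := hxw (1 + X) (by
    rw [add_comm, ← C_1, natDegree_X_add_C]; norm_num)
  have i0 := hpw 0
  have i1 := hpw 1
  have i2 := hpw 2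
  simp only [pow_zero, pow_one, mul_one, eval_one, eval_add, eval_X, Finset.univ_unique,
    Finset.sum_singleton, Nat.cast_zero, Nat.cast_one, add_zero, Nat.cast_ofNat] at e0 e1 i0 i1 i2
  have hI : ∫ y in (-1 : ℝ)..1, (1 + y) ^ (-α) * p.eval y
      = 2 * (2 ^ (1 - α) * 2 ^ 2 / (1 - α + 2)) - 4 * (2 ^ (1 - α) * 2 / (1 - α + 1))
        + 2 ^ (1 - α) / (1 - α) := by
    rw [← i0, ← i1, ← i2, ← intervalIntegral.integral_const_mul,
      ← intervalIntegral.integral_const_mul, ← intervalIntegral.integral_sub,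
      ← intervalIntegral.integral_add]
    · refine intervalIntegral.integral_congr fun y _ => ?_
      simp only [hp, eval_add, eval_sub, eval_mul, eval_pow, eval_ofNat, eval_one, eval_X]
      ring
    · simpa using ((hi 2).const_mul 2).sub ((hi 1).const_mul 4)
    · simpa using hi 0
    · exact (hi 2).const_mul 2
    · simpa using (hi 1).const_mul 4
  rw [hI]
  rw [i0] at e0
  rw [i1] at e1
  set m : ℝ := 2 ^ (1 - α) with hm
  have hm0 : 0 < m := by positivity
  set q : ℝ := 1 - α with hq
  have hq0 : 0 < q := by linarith
  -- The node is the mean of the normalized weight.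
  have hu : 1 + x default = 2 * q / (q + 1) := by
    rw [e0] at e1
    field_simp at e1 ⊢
    linarith
  simp only [Finset.univ_unique, Finset.sum_singleton, hp, eval_add, eval_sub, eval_mul, eval_pow,
    eval_ofNat, eval_one, eval_X, hu]
  rw [e0]
  have key : m / q * (2 * (2 * q / (q + 1)) ^ 2 - 4 * (2 * q / (q + 1)) + 1) -
      (2 * (m * 2 ^ 2 / (q + 2)) - 4 * (m * 2 / (q + 1)) + m / q)
      = -(m / q * (8 * q / ((q + 1) ^ 2 * (q + 2)))) := by
    field_simp
    ring
  rw [key, abs_neg, abs_of_pos (by positivity)]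
  refine mul_le_of_le_one_right (by positivity) ?_
  rw [div_le_one (by positivity)]
  nlinarith [sq_nonneg (q - 1), mul_nonneg hq0.le (sq_nonneg (q + 1))]

/-- Error of a Gauss--Jacobi rule for a function that is analytic and bounded on a half-plane
containing the Bernstein ellipse with parameter `ϱ`. -/
theorem norm_error_le (hxw : IsGaussJacobi α x w) (hα : α ∈ Ioo (0 : ℝ) 1) (hQ : 1 ≤ Q)
    {f : ℂ → ℂ} {ρ M : ℝ} (hρ : 1 < ρ)
    (hf : ∀ z : ℂ, -((ρ + ρ⁻¹) / 2) ≤ z.re → DifferentiableAt ℂ f z)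
    (hM : ∀ z : ℂ, -((ρ + ρ⁻¹) / 2) ≤ z.re → ‖f z‖ ≤ M) :
    ‖∑ j, w j • f (x j) - ∫ y in (-1 : ℝ)..1, (1 + y) ^ (-α) • f y‖
      ≤ 2 ^ (1 - α) / (1 - α) * M * (ρ ^ (-2 * (Q : ℤ) + 1) / (ρ - 1)) := by
  have hρ0 : 0 < ρ := by linarith
  have hi0 : 0 < ρ⁻¹ := by positivity
  have hi1 : ρ⁻¹ < 1 := inv_lt_one_of_one_lt₀ hρ
  have hα1 := hα.2
  set m : ℝ := 2 ^ (1 - α) / (1 - α) with hm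
  have hm0 : 0 < m := div_pos (by positivity) (by linarith)
  have hM0 : 0 ≤ M := (norm_nonneg _).trans (hM 0 (by simp; positivity))
  -- The expansion is stated for a left half-plane, so `f` is reflected; `P k` below undoes this.
  obtain ⟨a, ha2, ha3, hs⟩ := exists_chebyshev_expansion (f := fun z => f (-z)) hρ
    (fun z hz => (hf (-z) (by rw [Complex.neg_re]; linarith)).comp z differentiable_neg.differentiableAt)
    (fun z hz => hM (-z) (by rw [Complex.neg_re]; linarith))
  have ha : ∀ k, 2 ≤ k → ‖a k‖ ≤ M * ρ⁻¹ ^ k := by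
    intro k hk
    rcases hk.eq_or_lt with rfl | hk
    · exact ha2
    · refine (ha3 k hk).trans ?_
      gcongr
      linarith
  have hsa : Summable fun k => ‖a k‖ := by
    refine (summable_nat_add_iff 2).mp (Summable.of_nonneg_of_le (fun k => norm_nonneg _)
      (fun k => ha (k + 2) (by omega)) ?_)
    exact Summable.mul_left _ ((summable_nat_add_iff 2).mpr
      (summable_geometric_of_lt_one hi0.le hi1))
  let P : ℕ → ℝ[X] := fun k => (Chebyshev.T ℝ k).comp (-X)
  have hPd : ∀ k, (P k).natDegree = k := by
    intro k
    simp only [P]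
    rw [natDegree_comp, natDegree_neg, natDegree_X, Chebyshev.natDegree_T]
    simp
  have hPe : ∀ k y, (P k).eval y = (Chebyshev.T ℝ k).eval (-y) := fun k y => by simp [P]
  have hP1 : ∀ k, ∀ y ∈ Icc (-1 : ℝ) 1, |(P k).eval y| ≤ 1 := by
    intro k y hy
    rw [hPe]
    exact Chebyshev.abs_eval_T_real_le_one k (by rw [abs_neg]; exact abs_le.mpr hy)
  have hs' : ∀ y ∈ Icc (-1 : ℝ) 1,
      HasSum (fun k => a k * (((P k).eval y : ℝ) : ℂ)) (f y) := by
    intro y hy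
    have := hs (-y) ⟨by linarith [hy.2], by linarith [hy.1]⟩
    simpa only [Complex.ofReal_neg, neg_neg, ← hPe] using this
  let L : ℕ → ℝ := fun k =>
    ∑ j, w j * (P k).eval (x j) - ∫ y in (-1 : ℝ)..1, (1 + y) ^ (-α) * (P k).eval y
  have hL0 : ∀ k < 2 * Q, L k = 0 := fun k hk => sub_eq_zero.mpr (hxw _ (by rwa [hPd]))
  have hL : HasSum (fun k => a k * (L k : ℂ))
      (∑ j, w j • f (x j) - ∫ y in (-1 : ℝ)..1, (1 + y) ^ (-α) • f y) := by
    have h1 : HasSum (fun k => ∑ j, w j • (a k * (((P k).eval (x j) : ℝ) : ℂ)))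
        (∑ j, w j • f (x j)) :=
      hasSum_sum fun j _ => (hs' _ (hxw.node_mem hα1 j)).const_smul (w j)
    have hint := intervalIntegrable_one_add_rpow (β := -α) (by linarith)
    have h2 : HasSum
        (fun k => ∫ y in (-1 : ℝ)..1, (1 + y) ^ (-α) • (a k * (((P k).eval y : ℝ) : ℂ)))
        (∫ y in (-1 : ℝ)..1, (1 + y) ^ (-α) • f y) := by
      refine intervalIntegral.hasSum_integral_of_dominated_convergence
        (fun k y => ‖a k‖ * (1 + y) ^ (-α)) (fun k => ?_)
        (fun k => .of_forall fun y hy => ?_) (.of_forall fun y hy => hsa.mul_right _) ?_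
        (.of_forall fun y hy => ?_)
      · have hc : Continuous fun y : ℝ => a k * (((P k).eval y : ℝ) : ℂ) := by
          have := (P k).continuous
          fun_prop
        exact (intervalIntegrable_iff.mp
          (intervalIntegrable_jacobi_smul hα1 hc.continuousOn)).aestronglyMeasurable
      · rw [uIoc_of_le (by norm_num)] at hy
        have hy0 : 0 ≤ (1 + y) ^ (-α) := Real.rpow_nonneg (by linarith [hy.1]) _
        rw [norm_smul, norm_mul, Complex.norm_real, Real.norm_of_nonneg hy0, Real.norm_eq_abs,
          mul_comm]
        exact mul_le_mul_of_nonneg_right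
          (mul_le_of_le_one_right (norm_nonneg _) (hP1 k y ⟨hy.1.le, hy.2⟩)) hy0
      · simp only [tsum_mul_right]
        exact hint.const_mul _
      · rw [uIoc_of_le (by norm_num)] at hy
        exact (hs' y ⟨hy.1.le, hy.2⟩).const_smul _
    refine (h1.sub h2).congr_fun fun k => ?_
    have h3 : ∀ y : ℝ, (1 + y) ^ (-α) • (a k * (((P k).eval y : ℝ) : ℂ))
        = a k * (((1 + y) ^ (-α) * (P k).eval y : ℝ) : ℂ) := by
      intro y
      rw [Complex.real_smul]
      push_cast
      ring
    simp only [h3, intervalIntegral.integral_const_mul, intervalIntegral.integral_ofReal, L]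
    push_cast
    rw [mul_sub, Finset.mul_sum]
    congr 1
    refine Finset.sum_congr rfl fun j _ => ?_
    rw [Complex.real_smul]
    ring
  -- The factors balance as `M * m` for `k = 2` and as `(M / 2) * (2 * m)` for `k ≥ 3`.
  have hLa : ∀ k, 2 * Q ≤ k → ‖a k * (L k : ℂ)‖ ≤ m * M * ρ⁻¹ ^ k := by
    intro k hk
    rw [norm_mul, Complex.norm_real, Real.norm_eq_abs]
    rcases (show 2 ≤ k by omega).eq_or_lt with h2 | h3
    · obtain rfl : Q = 1 := by omega
      subst h2
      have hT : P 2 = 2 * (1 + X) ^ 2 - 4 * (1 + X) + 1 := by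
        simp only [P, Nat.cast_ofNat, Chebyshev.T_two, sub_comp, mul_comp, pow_comp, X_comp,
          ofNat_comp, one_comp]
        ring
      have h4 : |L 2| ≤ m := hxw.abs_error_chebyshev_two_le hα1 hT
      calc ‖a 2‖ * |L 2| ≤ (M * ρ⁻¹ ^ 2) * m := by gcongr
        _ = _ := by ring
    · have h4 : |L k| ≤ 2 * m := hxw.abs_error_le hα1 hQ (hP1 k)
      calc ‖a k‖ * |L k| ≤ (M / 2 * ρ⁻¹ ^ k) * (2 * m) := by
            gcongr
            exact ha3 k h3
        _ = _ := by ring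
  have hL' := (hasSum_nat_add_iff' (2 * Q)).mpr hL
  have hz : ∑ k ∈ Finset.range (2 * Q), a k * (L k : ℂ) = 0 :=
    Finset.sum_eq_zero fun k hk => by
      rw [hL0 k (Finset.mem_range.mp hk), Complex.ofReal_zero, mul_zero]
  rw [hz, sub_zero] at hL'
  have hgeo : HasSum (fun k => m * M * ρ⁻¹ ^ (k + 2 * Q))
      (m * M * (ρ ^ (-2 * (Q : ℤ) + 1) / (ρ - 1))) := by
    have h1 := ((hasSum_geometric_of_lt_one hi0.le hi1).mul_left (ρ⁻¹ ^ (2 * Q))).mul_left (m * M)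
    have e1 : ρ ^ (-2 * (Q : ℤ) + 1) / (ρ - 1) = ρ⁻¹ ^ (2 * Q) * (1 - ρ⁻¹)⁻¹ := by
      have h2 : ρ - 1 ≠ 0 := by linarith
      have h3 : (1 - ρ⁻¹) = (ρ - 1) / ρ := by field_simp
      rw [h3, zpow_add₀ hρ0.ne', neg_mul, _root_.zpow_neg, inv_pow, zpow_one, inv_div]
      norm_cast
      ring
    rw [e1]
    refine h1.congr_fun fun k => ?_
    rw [pow_add]
    ring
  exact hL'.norm_le_of_bounded hgeo fun k => hLa _ (by omega)

end IsGaussJacobi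

end GaussJacobi

/-! ### Reduction to scalar functions, and bounds for the method -/

/-- Hahn–Banach, extending `c • v ↦ c * p v` from the line through `v`. -/
theorem Seminorm.exists_dual_eq {E : Type*} [AddCommGroup E] [Module ℂ E] (p : Seminorm ℂ E)
    (v : E) : ∃ g : Module.Dual ℂ E, (∀ x, ‖g x‖ ≤ p x) ∧ ‖g v‖ = p v := by
  by_cases hv : v = 0
  · exact ⟨0, fun x => by simp, by simp [hv]⟩
  let φ : Module.Dual ℂ (Submodule.span ℂ {v}) :=
    ((p v : ℝ) : ℂ) • (LinearEquiv.toSpanNonzeroSingleton ℂ E v hv).symm.toLinearMap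
  have hφ : ∀ x, ‖φ x‖ = p x := by
    intro x
    obtain ⟨c, rfl⟩ := (LinearEquiv.toSpanNonzeroSingleton ℂ E v hv).surjective x
    have hφc : φ (LinearEquiv.toSpanNonzeroSingleton ℂ E v hv c) = ((p v : ℝ) : ℂ) * c :=
      congrArg (((p v : ℝ) : ℂ) * ·) (LinearEquiv.symm_apply_apply _ c)
    rw [hφc, LinearEquiv.toSpanNonzeroSingleton_apply, norm_mul, Complex.norm_real,
      Real.norm_of_nonneg (apply_nonneg p v), map_smul_eq_mul, mul_comm]
  obtain ⟨g, hg, hgp⟩ := Module.Dual.exists_extension_of_le_seminorm _ φ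
    (p := p) fun x => (hφ x).le
  refine ⟨g, hgp, ?_⟩
  rw [hg ⟨v, Submodule.mem_span_singleton_self v⟩, hφ]

theorem Matrix.differentiableAt_det {m : Type*} [Fintype m] [DecidableEq m]
    {B : ℂ → Matrix m m ℂ} {z : ℂ} (hB : ∀ i j, DifferentiableAt ℂ (fun z => B z i j) z) :
    DifferentiableAt ℂ (fun z => (B z).det) z := by
  simp only [det_apply']
  refine DifferentiableAt.fun_sum fun σ _ => DifferentiableAt.const_mul ?_ _
  exact DifferentiableAt.fun_finsetProd fun i _ => hB _ _

/-- Cramer's rule: the entries are polynomials in those of `B z`, divided by its determinant. -/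
theorem Matrix.differentiableAt_inv_apply {m : Type*} [Fintype m] [DecidableEq m]
    {B : ℂ → Matrix m m ℂ} {z : ℂ} (hB : ∀ i j, DifferentiableAt ℂ (fun z => B z i j) z)
    (hz : IsUnit (B z).det) (i j : m) : DifferentiableAt ℂ (fun z => (B z)⁻¹ i j) z := by
  simp only [inv_def, Ring.inverse_eq_inv', smul_apply, adjugate_apply, smul_eq_mul]
  refine ((differentiableAt_det hB).inv hz.ne_zero).mul (differentiableAt_det fun k l => ?_)
  simp only [updateRow_apply]
  split_ifs
  · exact differentiableAt_const _
  · exact hB k l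

namespace RungeKutta

variable {s : ℕ} (R : RungeKutta s)

theorem differentiableAt_resolvent {z : ℂ} (hz : IsUnit (1 - z • R.Ac).det)
    (i j : Fin (s + 1)) : DifferentiableAt ℂ (fun z : ℂ => (1 - z • R.Ac)⁻¹ i j) z := by
  refine differentiableAt_inv_apply (fun k l => ?_) hz i j
  simp only [Matrix.sub_apply, Matrix.smul_apply, smul_eq_mul]
  fun_prop

theorem differentiableAt_r {z : ℂ} (hz : IsUnit (1 - z • R.Ac).det) :
    DifferentiableAt ℂ R.r z := by
  refine (differentiableAt_id.mul (DifferentiableAt.fun_sum fun i _ => ?_)).const_add 1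
  exact (DifferentiableAt.fun_sum fun j _ =>
    (R.differentiableAt_resolvent hz i j).mul_const _).const_mul _

theorem differentiableAt_q {z : ℂ} (hz : IsUnit (1 - z • R.Ac).det) :
    DifferentiableAt ℂ R.q z := by
  rw [differentiableAt_pi]
  intro j
  have h : DifferentiableAt ℂ (fun z => ∑ i, R.bc i * (1 - z • R.Ac)⁻¹ i j) z :=
    DifferentiableAt.fun_sum fun i _ => (R.differentiableAt_resolvent hz i j).const_mul _
  exact h

variable {R} in
-- A-stability covers `Re z ≤ 0`, and the exponential bound covers the remaining strip up to `β`.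
theorem HasBounds.r_pow_le {N : Seminorm ℂ (Fin (s + 1) → ℂ)} {γ b Cq β : ℝ}
    (hbounds : R.HasBounds N γ b Cq) (hR : R.IsAdmissible) (hβ : 0 ≤ β) (hβb : β ≤ b) (n : ℕ)
    {z : ℂ} (hz : z.re ≤ β) : ‖R.r z‖ ^ n ≤ Real.exp (n * (γ * β)) := by
  have hγ := hbounds.one_lt
  rw [Real.exp_nat_mul]
  refine pow_le_pow_left₀ (norm_nonneg _) ?_ n
  rcases le_total z.re 0 with h0 | h0
  · exact (hR.aStable z h0).trans (Real.one_le_exp (by positivity))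
  · refine (hbounds.r_le z h0 (hz.trans hβb)).trans (Real.exp_le_exp.mpr ?_)
    gcongr

variable {R} in
/-- The quadrature error, bounded through an arbitrary admissible Bernstein ellipse. -/
theorem IsAdmissible.quadError_le (hR : R.IsAdmissible) {N : Seminorm ℂ (Fin (s + 1) → ℂ)}
    {γ b Cq : ℝ} (hbounds : R.HasBounds N γ b Cq) {α : ℝ} (hα : α ∈ Set.Ioo (0 : ℝ) 1)
    {h L₀ : ℝ} (hh : 0 < h) (hL₀ : 0 < L₀) (n : ℕ) {Q : ℕ} (hQ : 1 ≤ Q) {x w : Fin Q → ℝ}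
    (hxw : IsGaussJacobi α x w) {ρ β : ℝ} (hρ : 1 < ρ)
    (hβ : β = h * L₀ / 2 * ((ρ + ρ⁻¹) / 2 - 1)) (hβb : β ≤ b) :
    N (R.quadError α h L₀ n x w) ≤
      Cq * (h * L₀ ^ (1 - α) * Real.sin (Real.pi * α) / (Real.pi * (1 - α)))
        * (ρ ^ (-2 * (Q : ℤ) + 1) / (ρ - 1) * Real.exp (n * (γ * β))) := by
  set d : ℝ := (ρ + ρ⁻¹) / 2 with hd
  have hd1 : 1 ≤ d := by
    have := add_inv_le_add_inv le_rfl hρ.le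
    norm_num at this
    linarith
  have hβ0 : 0 ≤ β := by
    rw [hβ]
    exact mul_nonneg (by positivity) (by linarith)
  have hsin : 0 ≤ Real.sin (Real.pi * α) := by
    apply Real.sin_nonneg_of_nonneg_of_le_pi
    · exact mul_nonneg Real.pi_pos.le hα.1.le
    · exact mul_le_of_le_one_right Real.pi_pos.le hα.2.le
  set K : ℝ := h * Real.sin (Real.pi * α) / Real.pi * (L₀ / 2) ^ (1 - α) with hK
  have hK0 : 0 ≤ K := by positivity
  obtain ⟨l, hlN, hl⟩ := N.exists_dual_eq (R.quadError α h L₀ n x w)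
  set l' : (Fin (s + 1) → ℂ) →L[ℂ] ℂ := LinearMap.toContinuousLinearMap l with hl'
  have hll : ∀ v, l' v = l v := fun v => rfl
  -- This affine map sends `Re z ≥ -d` into `Re ≤ β`, which is where the value of `β` comes from.
  let ζ : ℂ → ℂ := fun z => -h * (z + 1) * L₀ / 2
  have hζre : ∀ z : ℂ, -d ≤ z.re → (ζ z).re ≤ β := by
    intro z hz
    have : ζ z = ((-h * L₀ / 2 : ℝ) : ℂ) * (z + 1) := by
      simp only [ζ]
      push_cast
      ring
    rw [this, Complex.re_ofReal_mul, Complex.add_re, Complex.one_re, hβ]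
    have : 0 < h * L₀ := by positivity
    nlinarith
  have hunit : ∀ z : ℂ, -d ≤ z.re → IsUnit (1 - ζ z • R.Ac).det := fun z hz =>
    hbounds.regular _ ((hζre z hz).trans hβb)
  let g : ℂ → Fin (s + 1) → ℂ := fun z => K • (R.r (ζ z) ^ n • R.q (ζ z))
  have hgd : ∀ z : ℂ, -d ≤ z.re → DifferentiableAt ℂ g z := by
    intro z hz
    have hζ : DifferentiableAt ℂ ζ z := by fun_prop
    have h1 : DifferentiableAt ℂ (fun z => R.r (ζ z)) z :=
      (R.differentiableAt_r (hunit z hz)).comp z hζ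
    have h2 : DifferentiableAt ℂ (fun z => R.q (ζ z)) z :=
      (R.differentiableAt_q (hunit z hz)).comp z hζ
    exact ((h1.pow n).smul h2).const_smul K
  have hgf : ∀ y : ℝ, -d ≤ y → R.f₀ α h L₀ n y = g y := by
    intro y hy
    have h1 : ((-h * (y + 1) * L₀ / 2 : ℝ) : ℂ) = ζ y := by
      simp only [ζ]
      push_cast
      ring
    rw [f₀, h1, R.e_eq hR.invertible hR.stifflyAccurate n (hunit y (by simpa using hy))]
  have hlg : ∀ z : ℂ, -d ≤ z.re → ‖l' (g z)‖ ≤ K * (Real.exp (n * (γ * β)) * Cq) := by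
    intro z hz
    rw [hll]
    refine (hlN _).trans ?_
    have hq := hbounds.q_le _ ((hζre z hz).trans hβb)
    have hr := hbounds.r_pow_le hR hβ0 hβb n (hζre z hz)
    have e1 : g z = (K : ℂ) • (R.r (ζ z) ^ n • R.q (ζ z)) := by
      ext i
      simp [g]
    rw [e1, map_smul_eq_mul, map_smul_eq_mul, Complex.norm_real, Real.norm_of_nonneg hK0, norm_pow]
    gcongr
  have hcomm : l' (R.quadError α h L₀ n x w)
      = ∑ j, w j • l' (g (x j)) - ∫ y in (-1 : ℝ)..1, (1 + y) ^ (-α) • l' (g y) := by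
    have hcont : ContinuousOn (fun y : ℝ => R.f₀ α h L₀ n y) (Set.Icc (-1) 1) := by
      have h1 : ContinuousOn (fun y : ℝ => g y) (Set.Icc (-1) 1) := by
        intro y hy
        have h2 := (hgd y (by simpa using by linarith [hy.1])).continuousAt
        exact (ContinuousAt.comp (f := fun y : ℝ => (y : ℂ)) h2
          Complex.continuous_ofReal.continuousAt).continuousWithinAt
      exact h1.congr fun y hy => hgf y (by linarith [hy.1])
    rw [quadError, map_sub, map_sum,
      ← ContinuousLinearMap.intervalIntegral_comp_comm l' (intervalIntegrable_jacobi_smul hα.2 hcont)]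
    congr 1
    · refine Finset.sum_congr rfl fun j _ => ?_
      rw [l'.map_smul_of_tower, hgf _ (by linarith [(hxw.node_mem hα.2 j).1])]
    · refine intervalIntegral.integral_congr fun y hy => ?_
      rw [Set.uIcc_of_le (by norm_num)] at hy
      rw [l'.map_smul_of_tower, hgf _ (by linarith [hy.1])]
  rw [← hl, ← hll, hcomm]
  refine (hxw.norm_error_le hα hQ (f := fun z => l' (g z)) hρ
    (fun z hz => l'.differentiableAt.comp z (hgd z hz)) hlg).trans (le_of_eq ?_)
  have e2 : (L₀ / 2) ^ (1 - α) * 2 ^ (1 - α) = L₀ ^ (1 - α) := by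
    rw [← Real.mul_rpow (by positivity) (by norm_num), div_mul_cancel₀ _ two_ne_zero]
  rw [← e2, hK]
  have : 1 - α ≠ 0 := by linarith [hα.2]
  field_simp

end RungeKutta

/-! ### Choice of the ellipse parameter -/

/-- With `d = 1 + u`, `rhoMax` is `d + √(d ^ 2 - 1)`, the larger root of `(ρ + ρ⁻¹) / 2 = d`. -/
theorem rhoMax_spec {b h L₀ : ℝ} (hb : 0 < b) (hh : 0 < h) (hL₀ : 0 < L₀) :
    1 < rhoMax b h L₀ ∧
      h * L₀ / 2 * ((rhoMax b h L₀ + (rhoMax b h L₀)⁻¹) / 2 - 1) = b := by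
  set u : ℝ := 2 * b / (L₀ * h) with hu
  have hu0 : 0 < u := by positivity
  have hub : h * L₀ / 2 * u = b := by rw [hu]; field_simp
  have e : rhoMax b h L₀ = 1 + u + √(u ^ 2 + 2 * u) := by
    rw [rhoMax, ← hu]
    congr 3
    rw [hu]
    ring
  rw [e]
  set r := √(u ^ 2 + 2 * u) with hr
  have hr0 : 0 ≤ r := Real.sqrt_nonneg _
  have hr2 : r ^ 2 = u ^ 2 + 2 * u := Real.sq_sqrt (by positivity)
  refine ⟨by linarith, ?_⟩
  have hinv : (1 + u + r)⁻¹ = 1 + u - r := inv_eq_of_mul_eq_one_right (by linear_combination -hr2)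
  rw [hinv, ← hub]
  ring

/-- Here `ρ - ρ⁻¹ = 2 * y`. For `y = 4Q / (γTL₀)` this is the stationarity condition for `ρ ^ (-2Q)
* exp (γTL₀ / 2 * ((ρ + ρ⁻¹) / 2 - 1))`. -/
theorem add_sqrt_spec {y : ℝ} (hy : 0 < y) :
    let ρ := y + √(1 + y ^ 2)
    2 * y ≤ ρ ∧ 1 + y ≤ ρ ∧ 0 ≤ (ρ + ρ⁻¹) / 2 - 1 ∧ (ρ + ρ⁻¹) / 2 - 1 ≤ y := by
  intro ρ
  set r := √(1 + y ^ 2) with hr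
  have hr0 : 0 ≤ r := Real.sqrt_nonneg _
  have hr2 : r ^ 2 = 1 + y ^ 2 := Real.sq_sqrt (by positivity)
  have hinv : ρ⁻¹ = r - y := inv_eq_of_mul_eq_one_right (by linear_combination hr2)
  have h1 : 1 ≤ r := by nlinarith
  have h2 : y ≤ r := by nlinarith
  have h3 : r ≤ 1 + y := by nlinarith
  rw [hinv]
  refine ⟨?_, ?_, ?_, ?_⟩ <;> simp only [ρ] <;> linarith

theorem zpow_div_sub_one_le {ρ y : ℝ} (hy : 0 < y) (h2 : 2 * y ≤ ρ) (h1 : 1 + y ≤ ρ) (Q : ℕ) :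
    ρ ^ (-2 * (Q : ℤ) + 1) / (ρ - 1) ≤ (1 + 1 / y) * (1 / (2 * y)) ^ (2 * Q) := by
  have hρ0 : 0 < ρ := by linarith
  have e1 : ρ ^ (-2 * (Q : ℤ) + 1) / (ρ - 1) = (1 + 1 / (ρ - 1)) * (1 / ρ) ^ (2 * Q) := by
    have : ρ - 1 ≠ 0 := by linarith
    rw [zpow_add₀ hρ0.ne', neg_mul, _root_.zpow_neg, zpow_one, one_div ρ, inv_pow]
    norm_cast
    field_simp
    ring
  rw [e1]
  have : y ≤ ρ - 1 := by linarith
  gcongr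

theorem mainTheorem4 {s : ℕ} (R : RungeKutta s) (hR : R.IsAdmissible)
    (N : Seminorm ℂ (Fin (s + 1) → ℂ)) (hN : ∀ v, N v = 0 → v = 0)
    (γ b Cq : ℝ) (hbounds : R.HasBounds N γ b Cq)
    (α : ℝ) (hα : α ∈ Set.Ioo (0 : ℝ) 1)
    (h T L₀ : ℝ) (hh : 0 < h) (hT : 0 < T) (hL₀ : 0 < L₀)
    (n : ℕ) (hn : n * h ≤ T)
    (Q : ℕ) (hQ : 1 ≤ Q) (x w : Fin Q → ℝ) (hxw : IsGaussJacobi α x w) :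
    (rhoOpt γ T L₀ Q ∈ Set.Ioo 1 (rhoMax b h L₀) →
      N (R.quadError α h L₀ n x w) ≤
        Cq * (h * L₀ ^ (1 - α) * Real.sin (Real.pi * α) / (Real.pi * (1 - α)))
          * (1 + γ * T * L₀ / (4 * Q)) * (Real.exp 1 * γ * T * L₀ / (8 * Q)) ^ (2 * Q)) ∧
    (rhoOpt γ T L₀ Q ∉ Set.Ioo 1 (rhoMax b h L₀) →
      N (R.quadError α h L₀ n x w) ≤
        Cq * (h * L₀ ^ (1 - α) * Real.sin (Real.pi * α) / (Real.pi * (1 - α)))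
          * (rhoMax b h L₀ ^ (-2 * (Q : ℤ) + 1) / (rhoMax b h L₀ - 1)
            * Real.exp (γ * T * b / h))) := by
  have hγ : 0 < γ := by linarith [hbounds.one_lt]
  have hC := hbounds.Cq_pos
  have hQ0 : (0 : ℝ) < Q := by exact_mod_cast hQ
  have hnT : (n : ℝ) ≤ T / h := by rwa [le_div_iff₀ hh]
  obtain ⟨hm1, hmb⟩ := rhoMax_spec hbounds.b_pos hh hL₀
  have hsin : 0 ≤ Real.sin (Real.pi * α) := by
    apply Real.sin_nonneg_of_nonneg_of_le_pi
    · exact mul_nonneg Real.pi_pos.le hα.1.le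
    · exact mul_le_of_le_one_right Real.pi_pos.le hα.2.le
  have hα1 : 0 < 1 - α := by linarith [hα.2]
  constructor
  · rintro ⟨ho1, hom⟩
    set y : ℝ := 4 * Q / (γ * T * L₀) with hy
    have hy0 : 0 < y := by positivity
    have hρ : rhoOpt γ T L₀ Q = y + √(1 + y ^ 2) := rfl
    obtain ⟨h1, h2, h3, h4⟩ := add_sqrt_spec hy0
    rw [← hρ] at h1 h2 h3 h4
    set ρ := rhoOpt γ T L₀ Q
    have hβb : h * L₀ / 2 * ((ρ + ρ⁻¹) / 2 - 1) ≤ b := by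
      rw [← hmb]
      have := add_inv_le_add_inv ho1.le hom.le
      gcongr
    refine (hR.quadError_le hbounds hα hh hL₀ n hQ hxw ho1 rfl hβb).trans ?_
    rw [mul_assoc _ (1 + _)]
    refine mul_le_mul_of_nonneg_left ?_ (by positivity)
    -- Bounding `(ρ + ρ⁻¹) / 2 - 1` by `y` makes the exponent exactly `2Q`, so the exponential
    -- merges with `(1 / (2 * y)) ^ (2 * Q)`.
    have hexp : Real.exp (n * (γ * (h * L₀ / 2 * ((ρ + ρ⁻¹) / 2 - 1))))
        ≤ Real.exp 1 ^ (2 * Q) := by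
      rw [← Real.exp_nat_mul]
      refine Real.exp_le_exp.mpr ?_
      calc (n : ℝ) * (γ * (h * L₀ / 2 * ((ρ + ρ⁻¹) / 2 - 1)))
          ≤ T / h * (γ * (h * L₀ / 2 * y)) := by gcongr
        _ = ((2 * Q : ℕ) : ℝ) * 1 := by
          rw [hy]
          push_cast
          field_simp
          ring
    calc _ ≤ (1 + 1 / y) * (1 / (2 * y)) ^ (2 * Q) * Real.exp 1 ^ (2 * Q) := by
          have := zpow_div_sub_one_le hy0 h1 h2 Q
          gcongr
      _ = _ := by
          rw [mul_assoc, ← mul_pow, hy]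
          congr 2
          · field_simp
          · field_simp
            ring
  · intro _
    refine (hR.quadError_le hbounds hα hh hL₀ n hQ hxw hm1 rfl hmb.le).trans ?_
    rw [hmb]
    have hm0 : 0 < rhoMax b h L₀ - 1 := by linarith
    have hm00 : 0 < rhoMax b h L₀ := by linarith
    have hexp : (n : ℝ) * (γ * b) ≤ γ * T * b / h := by
      have hb := hbounds.b_pos
      calc (n : ℝ) * (γ * b) ≤ T / h * (γ * b) := by gcongr
        _ = _ := by ring
    gcongr
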